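/- Corollary 4.2 (push-forward functor $q_*$). Let $\mathcal C$ be a strongly semi-abelian category, i.e. a pointed, Barr exact, protomodular category with finite coproducts in which every change of base functor of the fibration of points is left exact, conservative and reflects normal monomorphisms. For an object $A$ let $\mathrm{Pt}_A(\mathcal C)$ be the category of points over $A$: its objects are triples $(C,c,s_c)$ with $c\colon C\to A$ and $c s_c=1_A$, and its morphisms are the maps of domains over $A$ commuting with the projections and the sections. Pulling back along $g\colon E\to A$ gives the change of base functor $g^*\colon \mathrm{Pt}_A(\mathcal C)\to\mathrm{Pt}_E(\mathcal C)$. Let $q\colon A\to Q$ be a regular epimorphism with kernel $k\colon K\to A$, and let $\mathrm{Pt}_A(\mathcal C)|_k$ be the full subcategory of $\mathrm{Pt}_A(\mathcal C)$ on the points $(C,c,s_c)$ for which $k^*(C,c,s_c)$ is isomorphic in $\mathrm{Pt}_K(\mathcal C)$ to a product projection with its canonical section, $(Y\times K,\pi_2,\langle 0,1\rangle)$, for some object $Y$. Then $q$ induces a functor $$q_*\colon \mathrm{Pt}_A(\mathcal C)|_k\to\mathrm{Pt}_Q(\mathcal C).$$ That is, there are a functor $q_*$ and, for each point $P=(C,c,s_c)$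 in $\mathrm{Pt}_A(\mathcal C)|_k$ with $q_*P=(D,d,s_d)$, a map $\gamma_P\colon C\to D$, natural in $P$, such that $d\gamma_P=qc$, $\gamma_P s_c=s_d q$, and the square $d\gamma_P=qc$ is a pullback (so $(\gamma_P,q)\colon P\to q_*P$ is a cartesian morphism of points). The pair $(q_*,\gamma)$ is unique up to a unique isomorphism: for any other such pair $(q_*',\gamma')$ there is exactly one natural isomorphism $\alpha\colon q_*\cong q_*'$ with $\alpha_P\gamma_P=\gamma'_P$ for all $P$. -/

import Mathlib

open CategoryTheory CategoryTheory.Limits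

universe v u

-- Read every arrow `X ⟶ Y` directly through the category structure.
attribute [-instance] CategoryTheory.catToReflQuiver

namespace SplitEpis

/-- An object of the fibre `Pt_A(C)` of the fibration of points: a split epimorphism
`proj : X ⟶ A` together with a chosen section `sec : A ⟶ X`. -/
structure Pt {C : Type u} [Category.{v} C] (A : C) where
  /-- the domain of the split epimorphism -/
  X : C
  /-- the split epimorphism -/
  proj : X ⟶ A
  /-- the chosen section -/
  sec : A ⟶ X
  sec_proj : sec ≫ proj = 𝟙 A

attribute [simp] Pt.sec_proj

/-- A morphism of `Pt(C)` lying over `g : A ⟶ B`: the square of projections and the square of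
sections both commute. -/
@[ext]
structure HomOver {C : Type u} [Category.{v} C] {A B : C} (g : A ⟶ B) (P : Pt A) (P' : Pt B) where
  /-- the morphism between the domains -/
  hom : P.X ⟶ P'.X
  hom_proj : hom ≫ P'.proj = P.proj ≫ g
  sec_hom : P.sec ≫ hom = g ≫ P'.sec

/-- A morphism of points is cartesian when its square of projections is a pullback. -/
def HomOver.IsCartesian {C : Type u} [Category.{v} C] {A B : C} {g : A ⟶ B} {P : Pt A} {P' : Pt B}
    (f : HomOver g P P') : Prop :=
  IsPullback f.hom P.proj P'.proj g

/-- A morphism of the fibre `Pt_A(C)`: a morphism of points lying over the identity of `A`. -/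
@[ext]
structure Pt.Hom {C : Type u} [Category.{v} C] {A : C} (P P' : Pt A) where
  /-- the morphism between the domains -/
  hom : P.X ⟶ P'.X
  hom_proj : hom ≫ P'.proj = P.proj
  sec_hom : P.sec ≫ hom = P'.sec

attribute [simp] Pt.Hom.hom_proj Pt.Hom.sec_hom

/-- The category `Pt_A(C)`. -/
@[simps id_hom comp_hom]
instance Pt.category {C : Type u} [Category.{v} C] (A : C) : Category.{v} (Pt A) where
  Hom P P' := Pt.Hom P P'
  id P := { hom := 𝟙 P.X, hom_proj := by simp, sec_hom := by simp }
  comp f g :=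
    { hom := f.hom ≫ g.hom
      hom_proj := by rw [Category.assoc, g.hom_proj, f.hom_proj]
      sec_hom := by rw [← Category.assoc, f.sec_hom, g.sec_hom] }
  id_comp f := Pt.Hom.ext (Category.id_comp f.hom)
  comp_id f := Pt.Hom.ext (Category.comp_id f.hom)
  assoc f g h := Pt.Hom.ext (Category.assoc f.hom g.hom h.hom)

/-- The domain functor `Pt_A(C) ⥤ C`. -/
@[simps]
def domain {C : Type u} [Category.{v} C] (A : C) : Pt A ⥤ C where
  obj P := P.X
  map f := Pt.Hom.hom f

/-- The pullback of a point over `A` along `g : E ⟶ A`, with the induced section. -/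
noncomputable abbrev pullbackPt {C : Type u} [Category.{v} C] [HasPullbacks C] {E A : C}
    (g : E ⟶ A) (P : Pt A) : Pt E where
  X := pullback P.proj g
  proj := pullback.snd P.proj g
  sec := pullback.lift (g ≫ P.sec) (𝟙 E)
    (by rw [Category.assoc, P.sec_proj, Category.comp_id, Category.id_comp])
  sec_proj := pullback.lift_snd _ _ _

/-- The morphism induced between pullbacks by a morphism of points. -/
noncomputable abbrev pullbackPtMap {C : Type u} [Category.{v} C] [HasPullbacks C] {E A : C}
    (g : E ⟶ A) {P P' : Pt A} (f : P ⟶ P') : Pt.Hom (pullbackPt g P) (pullbackPt g P') where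
  hom := pullback.lift (pullback.fst P.proj g ≫ f.hom) (pullback.snd P.proj g)
    (by rw [Category.assoc, f.hom_proj, pullback.condition])
  hom_proj := pullback.lift_snd _ _ _
  sec_hom := by
    apply pullback.hom_ext
    · rw [Category.assoc, pullback.lift_fst, pullback.lift_fst, ← Category.assoc,
        pullback.lift_fst, Category.assoc, Pt.Hom.sec_hom]
    · rw [Category.assoc, pullback.lift_snd, pullback.lift_snd, pullback.lift_snd]

/-- The change of base functor `g^* : Pt_A(C) ⥤ Pt_E(C)` along `g : E ⟶ A`, given by pulling
back. -/
@[simps]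
noncomputable def changeOfBase {C : Type u} [Category.{v} C] [HasPullbacks C] {E A : C}
    (g : E ⟶ A) : Pt A ⥤ Pt E where
  obj P := pullbackPt g P
  map f := pullbackPtMap g f
  map_id P := Pt.Hom.ext (by
    apply pullback.hom_ext
    · simp
    · simp)
  map_comp f f' := Pt.Hom.ext (by
    apply pullback.hom_ext <;>
      simp [pullback.lift_fst, pullback.lift_snd, pullback.lift_fst_assoc])

/-- The kernel functor `K_A : Pt_A(C) ⥤ C`: change of base along the initial arrow `0 ⟶ A`,
followed by the domain functor (an isomorphism of categories when `C` is pointed). -/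
noncomputable def kernelFunctor {C : Type u} [Category.{v} C] [HasPullbacks C] [HasInitial C]
    (A : C) : Pt A ⥤ C :=
  changeOfBase (initial.to A) ⋙ domain (⊥_ C)

/-- A monomorphism `f : X ⟶ Y` is normal when it is an equivalence class of some internal
equivalence relation `(r₁, r₂) : R ⇉ Y`: the map `f × f : X × X ⟶ Y × Y` factors through a map
`t : X × X ⟶ R`, and the square formed by `t`, the first projection, `r₁` and `f` is a pullback
(whatever is related to a member of the class is in the class). -/
def IsNormalMono {D : Type u} [Category.{v} D] {X Y : D} (f : X ⟶ Y) : Prop :=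
  Mono f ∧
    ∃ (R : D) (r₁ r₂ : R ⟶ Y), IsEquivalenceRelation r₁ r₂ ∧
      ∃ (XX : D) (p₁ p₂ : XX ⟶ X) (_ : IsLimit (BinaryFan.mk p₁ p₂)) (t : XX ⟶ R),
        t ≫ r₂ = p₂ ≫ f ∧ IsPullback t p₁ r₁ f

/-- A functor is normal when it is left exact, conservative, and reflects normal
monomorphisms. -/
structure IsNormalFunctor {D D' : Type u} [Category.{v} D] [Category.{v} D'] (F : D ⥤ D') :
    Prop where
  leftExact : PreservesFiniteLimits F
  conservative : F.ReflectsIsomorphisms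
  reflectsNormalMono : ∀ {X Y : D} (f : X ⟶ Y), IsNormalMono (F.map f) → IsNormalMono f

/-- A Barr exact category: a regular category in which every internal equivalence relation is
effective, i.e. is the kernel pair of some morphism. -/
class BarrExact (C : Type u) [Category.{v} C] : Prop extends Regular C where
  effective : ∀ {R X : C} (r₁ r₂ : R ⟶ X), IsEquivalenceRelation r₁ r₂ →
    ∃ (Y : C) (f : X ⟶ Y), IsKernelPair f r₁ r₂

/-- A semi-abelian category: pointed, Barr exact, with finite coproducts, and protomodular
(the kernel functors reflect isomorphisms). -/
class SemiAbelian (C : Type u) [Category.{v} C] : Prop extends BarrExact C where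
  hasZeroObject : HasZeroObject C
  hasFiniteCoproducts : HasFiniteCoproducts C
  protomodular : ∀ A : C, (kernelFunctor A).ReflectsIsomorphisms

attribute [instance] SemiAbelian.hasZeroObject SemiAbelian.hasFiniteCoproducts

/-- A strongly semi-abelian category: a semi-abelian category which is strongly protomodular,
i.e. in which all change of base functors of the fibration of points are normal. -/
class StronglySemiAbelian (C : Type u) [Category.{v} C] : Prop extends SemiAbelian C where
  normal_changeOfBase : ∀ {E A : C} (g : E ⟶ A), IsNormalFunctor (changeOfBase g)

/-- The product projection `π₂ : Y × K ⟶ K` with its canonical section `⟨0, 1⟩`, as a point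
over `K`. -/
@[simps]
noncomputable def productPt {C : Type u} [Category.{v} C] [HasBinaryProducts C]
    [HasZeroMorphisms C] (Y K : C) : Pt K where
  X := Y ⨯ K
  proj := prod.snd
  sec := prod.lift 0 (𝟙 K)
  sec_proj := prod.lift_snd _ _

/-- The property defining `Pt_A(C)|_k`: the change of base along `k` is (isomorphic, as a point,
to) a product projection. -/
def IsTrivialAlong {C : Type u} [Category.{v} C] [HasPullbacks C] [HasBinaryProducts C]
    [HasZeroMorphisms C] {K A : C} (k : K ⟶ A) : ObjectProperty (Pt A) :=
  fun P => ∃ Y : C, Nonempty ((changeOfBase k).obj P ≅ productPt Y K)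

/-- A push-forward functor along `q : A ⟶ Q`, defined on `Pt_A(C)|_k`: a functor to `Pt_Q(C)`
equipped with cartesian morphisms of points `P ⟶ q_* P` over `q`, natural in `P`. -/
structure PushForward {C : Type u} [Category.{v} C] [HasPullbacks C] [HasBinaryProducts C]
    [HasZeroMorphisms C] {K A Q : C} (k : K ⟶ A) (q : A ⟶ Q) where
  /-- the functor `q_*` -/
  functor : (IsTrivialAlong k).FullSubcategory ⥤ Pt Q
  /-- the comparison morphisms over `q` -/
  unit : ∀ P : (IsTrivialAlong k).FullSubcategory, HomOver q P.obj (functor.obj P)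
  cartesian : ∀ P, (unit P).IsCartesian
  naturality : ∀ {P P' : (IsTrivialAlong k).FullSubcategory} (f : P ⟶ P'),
    Pt.Hom.hom f.hom ≫ (unit P').hom = (unit P).hom ≫ Pt.Hom.hom (functor.map f)

end SplitEpis

namespace SplitEpis

/-! In element notation, a point P = (C, c, s) descends along q once the kernel pair of q acts on
it: φ(x, a), defined when q(c x) = q(a), must move x into the fibre over a, with φ(x, c x) = x and
φ(s a, b) = s b.

The pairs (x, a) form a point over A, in which the pairs (s a, b) are a copy of the kernel pair of
q. The fibre of this inclusion over 0 is the section of k^*P. When k^*P is a product Y × K, that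
section is the fibre over 0 of a map to Y, hence normal, and strong protomodularity reflects
normality back to Pt_A (`isNormalMono_actionSecPt`). Modulo the resulting equivalence relation, each
(x, a) is related to exactly one pair (x', c x'), and φ(x, a) = x'
(`exists_action_of_isNormalMono`).

Protomodularity makes the two sections of a pullback of split epimorphisms jointly epic
(`hom_ext_of_sections`), so identities for φ need only be checked on them. Thus x ~ φ(x, a) is an
equivalence relation; exactness provides its quotient, and a Barr-Kock argument gives the pullback
square (`exists_isCartesian_of_action`). Joint epicness also makes cartesian maps over q opcartesian
(`exists_extension`), whence functoriality and uniqueness. -/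

variable {C : Type u} [Category.{v} C]

/-- Recognition of a pullback square by the existence and the uniqueness of lifts. -/
lemma isPullback_of_existsUnique {D : Type*} [Category* D] {W X Y Z : D} {a : W ⟶ X} {b : W ⟶ Y}
    {f : X ⟶ Z} {g : Y ⟶ Z} (w : a ≫ f = b ≫ g)
    (ex : ∀ (T : D) (x : T ⟶ X) (y : T ⟶ Y), x ≫ f = y ≫ g → ∃ l : T ⟶ W, l ≫ a = x ∧ l ≫ b = y)
    (uniq : ∀ (T : D) (l l' : T ⟶ W), l ≫ a = l' ≫ a → l ≫ b = l' ≫ b → l = l') :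
    IsPullback a b f g :=
  ⟨⟨w⟩, ⟨PullbackCone.isLimitAux' _ fun s =>
    ⟨(ex _ s.fst s.snd s.condition).choose, (ex _ s.fst s.snd s.condition).choose_spec.1,
      (ex _ s.fst s.snd s.condition).choose_spec.2, fun h₁ h₂ => uniq _ _ _
        (h₁.trans (ex _ s.fst s.snd s.condition).choose_spec.1.symm)
        (h₂.trans (ex _ s.fst s.snd s.condition).choose_spec.2.symm)⟩⟩⟩

/-! ### Limits and normal monomorphisms in the fibres, computed on domains. -/

section Domain

variable {A : C}

lemma Pt.hom_comp_proj {P P' : Pt A} (f : P ⟶ P') : Pt.Hom.hom f ≫ P'.proj = P.proj :=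
  Pt.Hom.hom_proj f

lemma Pt.sec_comp_hom {P P' : Pt A} (f : P ⟶ P') : P.sec ≫ Pt.Hom.hom f = P'.sec :=
  Pt.Hom.sec_hom f

lemma Pt.hom_comp {P P' P'' : Pt A} (f : P ⟶ P') (g : P' ⟶ P'') :
    Pt.Hom.hom (f ≫ g) = Pt.Hom.hom f ≫ Pt.Hom.hom g := rfl

lemma Pt.hom_ext {P P' : Pt A} {f g : P ⟶ P'} (h : Pt.Hom.hom f = Pt.Hom.hom g) : f = g :=
  Pt.Hom.ext h

lemma Pt.isIso_of_isIso_hom {P P' : Pt A} (f : P ⟶ P') [IsIso (Pt.Hom.hom f)] : IsIso f := by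
  let g : P' ⟶ P :=
    { hom := inv (Pt.Hom.hom f)
      hom_proj := by rw [IsIso.inv_comp_eq, Pt.hom_comp_proj]
      sec_hom := by rw [IsIso.comp_inv_eq, Pt.sec_comp_hom] }
  exact ⟨g, Pt.hom_ext (IsIso.hom_inv_id (Pt.Hom.hom f)),
    Pt.hom_ext (IsIso.inv_hom_id (Pt.Hom.hom f))⟩

lemma Pt.isIso_hom {P P' : Pt A} (f : P ⟶ P') [IsIso f] : IsIso (Pt.Hom.hom f) :=
  inferInstanceAs (IsIso ((domain A).map f))

/-- The pullback of two morphisms of points, computed on domains. -/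
@[simps]
noncomputable def pullbackObj [HasPullbacks C] {P P' Z : Pt A} (f : P ⟶ Z) (g : P' ⟶ Z) : Pt A where
  X := pullback (Pt.Hom.hom f) (Pt.Hom.hom g)
  proj := pullback.fst _ _ ≫ P.proj
  sec := pullback.lift P.sec P'.sec (by rw [Pt.sec_comp_hom, Pt.sec_comp_hom])
  sec_proj := by rw [pullback.lift_fst_assoc, P.sec_proj]

/-- The first projection of the pullback of two morphisms of points. -/
noncomputable def pullbackObjFst [HasPullbacks C] {P P' Z : Pt A} (f : P ⟶ Z) (g : P' ⟶ Z) :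
    pullbackObj f g ⟶ P where
  hom := pullback.fst _ _
  hom_proj := rfl
  sec_hom := pullback.lift_fst _ _ _

/-- The second projection of the pullback of two morphisms of points. -/
noncomputable def pullbackObjSnd [HasPullbacks C] {P P' Z : Pt A} (f : P ⟶ Z) (g : P' ⟶ Z) :
    pullbackObj f g ⟶ P' where
  hom := pullback.snd _ _
  hom_proj := by
    have h : pullback.snd (Pt.Hom.hom f) (Pt.Hom.hom g) ≫ P'.proj
        = pullback.fst (Pt.Hom.hom f) (Pt.Hom.hom g) ≫ P.proj := by
      rw [← Pt.hom_comp_proj g, ← pullback.condition_assoc, Pt.hom_comp_proj]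
    exact h
  sec_hom := pullback.lift_snd _ _ _

/-- The domain functor reflects pullback squares. -/
lemma Pt.isPullback_of_hom {W P P' Z : Pt A} {a : W ⟶ P} {b : W ⟶ P'} {f : P ⟶ Z} {g : P' ⟶ Z}
    (h : IsPullback (Pt.Hom.hom a) (Pt.Hom.hom b) (Pt.Hom.hom f) (Pt.Hom.hom g)) :
    IsPullback a b f g := by
  refine isPullback_of_existsUnique (Pt.hom_ext h.w) (fun T x y e => ?_) fun T l l' h₁ h₂ =>
    Pt.hom_ext (h.hom_ext (congrArg Pt.Hom.hom h₁) (congrArg Pt.Hom.hom h₂))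
  let l : T ⟶ W :=
    { hom := h.lift (Pt.Hom.hom x) (Pt.Hom.hom y) (congrArg Pt.Hom.hom e)
      hom_proj := by rw [← Pt.hom_comp_proj a, h.lift_fst_assoc, Pt.hom_comp_proj]
      sec_hom := by
        apply h.hom_ext
        · rw [Category.assoc, h.lift_fst, Pt.sec_comp_hom, Pt.sec_comp_hom]
        · rw [Category.assoc, h.lift_snd, Pt.sec_comp_hom, Pt.sec_comp_hom] }
  exact ⟨l, Pt.hom_ext (h.lift_fst _ _ _), Pt.hom_ext (h.lift_snd _ _ _)⟩

lemma isPullback_pullbackObj [HasPullbacks C] {P P' Z : Pt A} (f : P ⟶ Z) (g : P' ⟶ Z) :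
    IsPullback (pullbackObjFst f g) (pullbackObjSnd f g) f g :=
  Pt.isPullback_of_hom (IsPullback.of_hasPullback (Pt.Hom.hom f) (Pt.Hom.hom g))

/-- The domain functor preserves pullback squares. -/
lemma Pt.isPullback_hom [HasPullbacks C] {W P P' Z : Pt A} {a : W ⟶ P} {b : W ⟶ P'} {f : P ⟶ Z}
    {g : P' ⟶ Z} (h : IsPullback a b f g) :
    IsPullback (Pt.Hom.hom a) (Pt.Hom.hom b) (Pt.Hom.hom f) (Pt.Hom.hom g) := by
  have h' := isPullback_pullbackObj f g
  obtain ⟨e, he⟩ : ∃ e : W ≅ pullbackObj f g, e = h.isoIsPullback _ _ h' := ⟨_, rfl⟩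
  have h₁ : e.inv ≫ a = pullbackObjFst f g := by rw [he]; exact h.isoIsPullback_inv_fst _ _ h'
  have h₂ : e.inv ≫ b = pullbackObjSnd f g := by rw [he]; exact h.isoIsPullback_inv_snd _ _ h'
  refine IsPullback.of_iso (IsPullback.of_hasPullback (Pt.Hom.hom f) (Pt.Hom.hom g))
    ((domain A).mapIso e).symm (Iso.refl _) (Iso.refl _) (Iso.refl _) ?_ ?_ ?_ ?_
  · exact (Category.comp_id _).trans (congrArg Pt.Hom.hom h₁).symm
  · exact (Category.comp_id _).trans (congrArg Pt.Hom.hom h₂).symm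
  · simp
  · simp

/-- The domain functor preserves jointly monic pairs of parallel morphisms. -/
lemma Pt.hom_eq_of_jointlyMono [HasPullbacks C] [HasBinaryProducts C] {R P : Pt A} {r₁ r₂ : R ⟶ P}
    (h : JointlyMono₂ r₁ r₂) {T : C} {x y : T ⟶ R.X}
    (h₁ : x ≫ Pt.Hom.hom r₁ = y ≫ Pt.Hom.hom r₁)
    (h₂ : x ≫ Pt.Hom.hom r₂ = y ≫ Pt.Hom.hom r₂) : x = y := by
  obtain ⟨d, hd₁, hd₂⟩ : ∃ d : R.X ⟶ P.X ⨯ P.X,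
      d ≫ prod.fst = Pt.Hom.hom r₁ ∧ d ≫ prod.snd = Pt.Hom.hom r₂ :=
    ⟨prod.lift _ _, prod.lift_fst _ _, prod.lift_snd _ _⟩
  have e₁ : pullback.fst d d ≫ Pt.Hom.hom r₁ = pullback.snd d d ≫ Pt.Hom.hom r₁ := by
    rw [← hd₁]; exact pullback.condition_assoc _
  have e₂ : pullback.fst d d ≫ Pt.Hom.hom r₂ = pullback.snd d d ≫ Pt.Hom.hom r₂ := by
    rw [← hd₂]; exact pullback.condition_assoc _
  -- The hypothesis only tests maps of points, while `T` is a bare object. The kernel pair of `d` is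
  -- itself a point over `A`, and the pair `x`, `y` factors through it.
  let V : Pt A :=
    { X := pullback d d
      proj := pullback.fst d d ≫ R.proj
      sec := pullback.lift R.sec R.sec rfl
      sec_proj := by rw [pullback.lift_fst_assoc, R.sec_proj] }
  let a : V ⟶ R := { hom := pullback.fst d d, hom_proj := rfl, sec_hom := pullback.lift_fst _ _ _ }
  let b : V ⟶ R :=
    { hom := pullback.snd d d
      hom_proj := by
        rw [← Pt.hom_comp_proj r₁, ← reassoc_of% e₁, Pt.hom_comp_proj]
      sec_hom := pullback.lift_snd _ _ _ }
  have hab : a = b := h.right_cancellation a b (Pt.hom_ext e₁) (Pt.hom_ext e₂)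
  have hxy : x ≫ d = y ≫ d := by
    apply Limits.prod.hom_ext
    · rwa [Category.assoc, Category.assoc, hd₁]
    · rwa [Category.assoc, Category.assoc, hd₂]
  exact (pullback.lift_fst x y hxy).symm.trans ((congrArg (fun t => pullback.lift x y hxy ≫
    Pt.Hom.hom t) hab).trans (pullback.lift_snd x y hxy))

/-- A morphism of points which is the fibre of a morphism over the zero point is a normal
monomorphism. -/
lemma isNormalMono_of_isPullback [HasPullbacks C] {M P Z : Pt A} (m : M ⟶ P) (u : P ⟶ Z)
    (h : IsPullback (Pt.Hom.hom m) M.proj (Pt.Hom.hom u) Z.sec) : IsNormalMono m := by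
  have hZ : Mono Z.sec := ⟨fun x y e => by simpa using e =≫ Z.proj⟩
  have hm : Mono (Pt.Hom.hom m) := ⟨fun x y e => h.hom_ext e (by
    rw [← cancel_mono Z.sec, Category.assoc, Category.assoc, ← h.w, reassoc_of% e])⟩
  have hu := isPullback_pullbackObj u u
  refine ⟨⟨fun x y e => Pt.hom_ext ((cancel_mono (Pt.Hom.hom m)).1 (congrArg Pt.Hom.hom e))⟩,
    pullbackObj u u, pullbackObjFst u u, pullbackObjSnd u u, ⟨⟨IsKernelPair.equivalenceRelation u
      _ _ (isPullback_pullbackObj (pullbackObjSnd u u) (pullbackObjFst u u)).isLimit hu⟩⟩, ?_⟩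
  -- The square of `M` in the fibre is its fibre product over `A`.
  let XX : Pt A :=
    { X := pullback M.proj M.proj
      proj := pullback.fst _ _ ≫ M.proj
      sec := pullback.lift M.sec M.sec rfl
      sec_proj := by rw [pullback.lift_fst_assoc, M.sec_proj] }
  let p₁ : XX ⟶ M :=
    { hom := pullback.fst _ _, hom_proj := rfl, sec_hom := pullback.lift_fst _ _ _ }
  let p₂ : XX ⟶ M :=
    { hom := pullback.snd _ _, hom_proj := pullback.condition.symm
      sec_hom := pullback.lift_snd _ _ _ }
  have hmu (p : XX ⟶ M) : Pt.Hom.hom (p ≫ m ≫ u) = XX.proj ≫ Z.sec := by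
    rw [Pt.hom_comp, Pt.hom_comp, h.w, reassoc_of% @Pt.hom_comp_proj]
  let t : XX ⟶ pullbackObj u u := hu.lift (p₁ ≫ m) (p₂ ≫ m)
    (Pt.hom_ext (by rw [Category.assoc, Category.assoc, hmu, hmu]))
  have ht₁ : t ≫ pullbackObjFst u u = p₁ ≫ m := hu.lift_fst _ _ _
  have ht₂ : t ≫ pullbackObjSnd u u = p₂ ≫ m := hu.lift_snd _ _ _
  have ht₁' := congrArg Pt.Hom.hom ht₁
  have ht₂' := congrArg Pt.Hom.hom ht₂
  have hu' := Pt.isPullback_hom hu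
  simp only [Pt.hom_comp] at ht₁' ht₂'
  have hXX {N : Pt A} (x y : N ⟶ M) : ∃ l : N ⟶ XX, l ≫ p₁ = x ∧ l ≫ p₂ = y := by
    refine ⟨⟨pullback.lift (Pt.Hom.hom x) (Pt.Hom.hom y)
      (by rw [Pt.hom_comp_proj, Pt.hom_comp_proj]), ?_, ?_⟩, Pt.hom_ext (pullback.lift_fst _ _ _),
      Pt.hom_ext (pullback.lift_snd _ _ _)⟩
    · rw [pullback.lift_fst_assoc, Pt.hom_comp_proj]
    · apply pullback.hom_ext
      · rw [Category.assoc, pullback.lift_fst, Pt.sec_comp_hom, pullback.lift_fst]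
      · rw [Category.assoc, pullback.lift_snd, Pt.sec_comp_hom, pullback.lift_snd]
  have hXX' {N : Pt A} (l l' : N ⟶ XX) (e₁ : l ≫ p₁ = l' ≫ p₁) (e₂ : l ≫ p₂ = l' ≫ p₂) :
      l = l' :=
    Pt.hom_ext (pullback.hom_ext (congrArg Pt.Hom.hom e₁) (congrArg Pt.Hom.hom e₂))
  refine ⟨XX, p₁, p₂, BinaryFan.isLimitMk (fun s => (hXX s.fst s.snd).choose)
    (fun s => (hXX s.fst s.snd).choose_spec.1) (fun s => (hXX s.fst s.snd).choose_spec.2)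
    (fun s _ h₁ h₂ => hXX' _ _ (h₁.trans (hXX s.fst s.snd).choose_spec.1.symm)
      (h₂.trans (hXX s.fst s.snd).choose_spec.2.symm)), t, ht₂,
    Pt.isPullback_of_hom (isPullback_of_existsUnique ht₁' (fun T x y e => ?_)
      fun T l l' e₁ e₂ => ?_)⟩
  -- If the first member of a pair in the kernel pair of `u` lies in `M`, then `u` sends the second
  -- member into the zero section as well, so `h` puts it in `M`.
  · have e' : (x ≫ Pt.Hom.hom (pullbackObjSnd u u)) ≫ Pt.Hom.hom u = (y ≫ M.proj) ≫ Z.sec := by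
      rw [Category.assoc, ← hu'.w, ← Category.assoc, e, Category.assoc, h.w, Category.assoc]
    let l : T ⟶ XX.X := pullback.lift y (h.lift _ _ e') (h.lift_snd _ _ _).symm
    have l₁ : l ≫ Pt.Hom.hom p₁ = y := pullback.lift_fst _ _ _
    have l₂ : l ≫ Pt.Hom.hom p₂ = h.lift _ _ e' := pullback.lift_snd _ _ _
    refine ⟨l, hu'.hom_ext ?_ ?_, l₁⟩
    · rw [Category.assoc, ht₁', reassoc_of% l₁, e]
    · rw [Category.assoc, ht₂', reassoc_of% l₂, h.lift_fst]
  · refine pullback.hom_ext e₂ ((cancel_mono (Pt.Hom.hom m)).1 ?_)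
    have e₃ : l ≫ Pt.Hom.hom p₂ ≫ Pt.Hom.hom m = l' ≫ Pt.Hom.hom p₂ ≫ Pt.Hom.hom m := by
      rw [← ht₂', reassoc_of% e₁]
    exact (Category.assoc _ _ _).trans (e₃.trans (Category.assoc _ _ _).symm)

end Domain

/-! ### Consequences of conservative change of base. -/

section Protomodular

variable [HasPullbacks C]

/-- Conservativity of a change of base functor, expressed on domains. -/
lemma isIso_of_isIso_pullbackMap {B E : C} (t : E ⟶ B) [(changeOfBase t).ReflectsIsomorphisms]
    {P P' : Pt B} (f : P ⟶ P') (v : pullback P'.proj t ⟶ pullback P.proj t)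
    (hv : v ≫ pullback.fst P.proj t ≫ Pt.Hom.hom f = pullback.fst P'.proj t)
    (hv' : v ≫ pullback.snd P.proj t = pullback.snd P'.proj t)
    (hm : ∀ {T : C} (x y : T ⟶ pullback P.proj t),
      x ≫ pullback.fst P.proj t ≫ Pt.Hom.hom f = y ≫ pullback.fst P.proj t ≫ Pt.Hom.hom f →
      x ≫ pullback.snd P.proj t = y ≫ pullback.snd P.proj t → x = y) :
    IsIso (Pt.Hom.hom f) := by
  let F : pullback P.proj t ⟶ pullback P'.proj t := Pt.Hom.hom ((changeOfBase t).map f)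
  have h₁ : F ≫ pullback.fst P'.proj t = pullback.fst P.proj t ≫ Pt.Hom.hom f :=
    pullback.lift_fst _ _ _
  have h₂ : F ≫ pullback.snd P'.proj t = pullback.snd P.proj t := pullback.lift_snd _ _ _
  have hvF : v ≫ F = 𝟙 (pullback P'.proj t) := by
    apply pullback.hom_ext
    · rw [Category.assoc, h₁, hv, Category.id_comp]
    · rw [Category.assoc, h₂, hv', Category.id_comp]
  have hFv : F ≫ v = 𝟙 (pullback P.proj t) := by
    apply hm
    · rw [Category.assoc, hv, h₁, Category.id_comp]
    · rw [Category.assoc, hv', h₂, Category.id_comp]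
  have : IsIso (Pt.Hom.hom ((changeOfBase t).map f)) := ⟨v, hFv, hvF⟩
  have := Pt.isIso_of_isIso_hom ((changeOfBase t).map f)
  have := isIso_of_reflects_iso f (changeOfBase t)
  exact Pt.isIso_hom f

/-- In a pullback of split epimorphisms, a subobject through which both canonical sections
factor is everything. -/
lemma isIso_of_mono_of_sections {X X' A Z W : C} {f : X ⟶ A} {g : X' ⟶ A}
    {t : A ⟶ X'} [(changeOfBase t).ReflectsIsomorphisms] (ht : t ≫ g = 𝟙 A) {p : Z ⟶ X}
    {p' : Z ⟶ X'} (h : IsPullback p p' f g) (m : W ⟶ Z) [Mono m] (i : X ⟶ W) (i' : X' ⟶ W)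
    (hi : i ≫ m ≫ p = 𝟙 X) (hi' : i ≫ m ≫ p' = f ≫ t)
    (hj' : i' ≫ m ≫ p' = 𝟙 X') : IsIso m := by
  let P : Pt X' := ⟨W, m ≫ p', i', hj'⟩
  let P' : Pt X' := ⟨Z, p', i' ≫ m, by rw [Category.assoc, hj']⟩
  let F : P ⟶ P' := ⟨m, rfl, rfl⟩
  have e : pullback.fst p' t ≫ p' = pullback.snd p' t ≫ t := pullback.condition
  have e' : pullback.fst p' t ≫ p ≫ f = pullback.snd p' t := by
    rw [h.w, reassoc_of% e, ht, Category.comp_id]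
  -- Since `t` splits `g`, pulling `Z` back along `t` recovers `X`; there `i` supplies the inverse
  -- of the restriction of `m`.
  refine isIso_of_isIso_pullbackMap t F (pullback.lift (pullback.fst p' t ≫ p ≫ i)
    (pullback.snd p' t) ?_) ?_ (pullback.lift_snd _ _ _) fun x y h₁ h₂ => ?_
  · simp only [P, Category.assoc]
    rw [hi', reassoc_of% e']
  · rw [pullback.lift_fst_assoc]
    apply h.hom_ext
    · simp only [F, Category.assoc, hi, Category.comp_id]
      rfl
    · simp only [F, Category.assoc, hi']
      exact ((reassoc_of% e') t).trans e.symm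
  · refine pullback.hom_ext ((cancel_mono m).1 ?_) h₂
    simpa only [Category.assoc] using h₁

/-- In a pullback of split epimorphisms, the two canonical sections are jointly epic. -/
lemma hom_ext_of_sections {X X' A Z : C} [HasEqualizers C] {f : X ⟶ A} {g : X' ⟶ A}
    {t : A ⟶ X'} [(changeOfBase t).ReflectsIsomorphisms] (ht : t ≫ g = 𝟙 A) {p : Z ⟶ X}
    {p' : Z ⟶ X'} (h : IsPullback p p' f g) (i : X ⟶ Z) (i' : X' ⟶ Z)
    (hi : i ≫ p = 𝟙 X) (hi' : i ≫ p' = f ≫ t)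
    (hj' : i' ≫ p' = 𝟙 X') {T : C} {a b : Z ⟶ T} (h₁ : i ≫ a = i ≫ b) (h₂ : i' ≫ a = i' ≫ b) :
    a = b := by
  have := isIso_of_mono_of_sections ht h (equalizer.ι a b) (equalizer.lift i h₁)
    (equalizer.lift i' h₂) (by rw [equalizer.lift_ι_assoc, hi])
    (by rw [equalizer.lift_ι_assoc, hi'])
    (by rw [equalizer.lift_ι_assoc, hj'])
  rw [← cancel_epi (equalizer.ι a b), equalizer.condition]

/-- A morphism is monic as soon as one of its fibres is trivial. -/
lemma mono_of_fibre_trivial {W X E : C} (f : W ⟶ X) (h : E ⟶ W)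
    [(changeOfBase h).ReflectsIsomorphisms]
    (H : ∀ {T : C} (e : T ⟶ E) (w : T ⟶ W), w ≫ f = e ≫ h ≫ f → w = e ≫ h) : Mono f := by
  -- A map is monic when the diagonal of its kernel pair is invertible. This diagonal is a map of
  -- points over `W`, and `H` says that it becomes invertible over `h`.
  let P : Pt W := ⟨W, 𝟙 W, 𝟙 W, Category.id_comp _⟩
  let P' : Pt W := ⟨pullback f f, pullback.fst f f, pullback.lift (𝟙 W) (𝟙 W) rfl,
    pullback.lift_fst _ _ _⟩
  let δ : W ⟶ pullback f f := pullback.lift (𝟙 W) (𝟙 W) rfl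
  have hδ₁ : δ ≫ pullback.fst f f = 𝟙 W := pullback.lift_fst _ _ _
  have hδ₂ : δ ≫ pullback.snd f f = 𝟙 W := pullback.lift_snd _ _ _
  let F : P ⟶ P' := ⟨δ, pullback.lift_fst _ _ _, Category.id_comp _⟩
  have e : pullback.fst (pullback.fst f f) h ≫ pullback.fst f f
      = pullback.snd (pullback.fst f f) h ≫ h := pullback.condition
  have : IsIso δ := by
    refine isIso_of_isIso_pullbackMap h F (pullback.lift
      (pullback.snd (pullback.fst f f) h ≫ h) (pullback.snd (pullback.fst f f) h)
      (Category.comp_id _)) ?_ (pullback.lift_snd _ _ _) fun x y h₁ h₂ => ?_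
    · rw [pullback.lift_fst_assoc]
      apply pullback.hom_ext
      · simp only [F, Category.assoc]
        rw [hδ₁, Category.comp_id]
        exact e.symm
      · simp only [F, Category.assoc]
        rw [hδ₂, Category.comp_id]
        refine (H (pullback.snd (pullback.fst f f) h) _ ?_).symm
        rw [Category.assoc, ← pullback.condition]
        exact ((reassoc_of% e) f)
    · have hx (z) (x : z ⟶ pullback P.proj h) :
          x ≫ pullback.fst P.proj h = x ≫ pullback.snd P.proj h ≫ h := by
        rw [← pullback.condition]
        exact congrArg _ (Category.comp_id _).symm
      refine pullback.hom_ext ?_ h₂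
      rw [hx, hx, reassoc_of% h₂]
  refine IsKernelPair.mono_of_eq_fst_snd (IsKernelPair.of_hasPullback f) ?_
  rw [← cancel_epi δ, hδ₁, hδ₂]

end Protomodular

/-! ### The point of pairs (x, a), and normality of the kernel pair inside it. -/

section Action

instance [StronglySemiAbelian C] {E A : C} (g : E ⟶ A) :
    (changeOfBase g).ReflectsIsomorphisms :=
  (StronglySemiAbelian.normal_changeOfBase g).conservative

variable {A Q : C}

/-- The point over `A` of pairs `(x, a)` such that `q` identifies the projection of `x` with `a`. -/
noncomputable abbrev actionPt [HasPullbacks C] (q : A ⟶ Q) (P : Pt A) : Pt A where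
  X := pullback (P.proj ≫ q) q
  proj := pullback.snd _ _
  sec := pullback.lift P.sec (𝟙 A) (by rw [← Category.assoc, P.sec_proj])
  sec_proj := pullback.lift_snd _ _ _

/-- The kernel pair of `q` as a point over `A`, with the diagonal as its section. -/
noncomputable abbrev kernelPairPt [HasPullbacks C] (q : A ⟶ Q) : Pt A where
  X := pullback q q
  proj := pullback.snd _ _
  sec := pullback.lift (𝟙 A) (𝟙 A) rfl
  sec_proj := pullback.lift_snd _ _ _

section Pullbacks

variable [HasPullbacks C] (q : A ⟶ Q) (P : Pt A)

/-- The map `x ↦ (x, P.proj x)`. -/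
noncomputable def actionUnit : P.X ⟶ pullback (P.proj ≫ q) q :=
  pullback.lift (𝟙 _) P.proj (Category.id_comp _)

/-- The map `(a, b) ↦ (P.sec a, b)`. -/
noncomputable def actionSec : pullback q q ⟶ pullback (P.proj ≫ q) q :=
  pullback.lift (pullback.fst q q ≫ P.sec) (pullback.snd q q)
    (by rw [Category.assoc, ← Category.assoc P.sec, P.sec_proj, Category.id_comp,
      pullback.condition])

@[simp]
lemma actionUnit_fst : actionUnit q P ≫ pullback.fst (P.proj ≫ q) q = 𝟙 _ :=
  pullback.lift_fst _ _ _

@[simp]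
lemma actionUnit_snd : actionUnit q P ≫ pullback.snd (P.proj ≫ q) q = P.proj :=
  pullback.lift_snd _ _ _

@[simp]
lemma actionSec_fst :
    actionSec q P ≫ pullback.fst (P.proj ≫ q) q = pullback.fst q q ≫ P.sec :=
  pullback.lift_fst _ _ _

@[simp]
lemma actionSec_snd : actionSec q P ≫ pullback.snd (P.proj ≫ q) q = pullback.snd q q :=
  pullback.lift_snd _ _ _

lemma sec_actionUnit : P.sec ≫ actionUnit q P = (actionPt q P).sec := by
  apply pullback.hom_ext
  · rw [Category.assoc, actionUnit_fst, Category.comp_id, pullback.lift_fst]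
  · rw [Category.assoc, actionUnit_snd, P.sec_proj, pullback.lift_snd]

lemma sec_actionSec : (kernelPairPt q).sec ≫ actionSec q P = (actionPt q P).sec := by
  apply pullback.hom_ext
  · rw [Category.assoc, actionSec_fst, pullback.lift_fst_assoc, Category.id_comp,
      pullback.lift_fst]
  · rw [Category.assoc, actionSec_snd, pullback.lift_snd, pullback.lift_snd]

/-- `actionSec` as a morphism of points. -/
noncomputable def actionSecPt : kernelPairPt q ⟶ actionPt q P where
  hom := actionSec q P
  hom_proj := actionSec_snd q P
  sec_hom := sec_actionSec q P

/-- The comparison of `actionPt q P` with the kernel pair of `q`. -/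
noncomputable def actionToKernelPair : pullback (P.proj ≫ q) q ⟶ pullback q q :=
  pullback.lift (pullback.fst (P.proj ≫ q) q ≫ P.proj) (pullback.snd (P.proj ≫ q) q)
    (by rw [Category.assoc, pullback.condition])

@[simp]
lemma actionToKernelPair_fst : actionToKernelPair q P ≫ pullback.fst q q
    = pullback.fst (P.proj ≫ q) q ≫ P.proj :=
  pullback.lift_fst _ _ _

@[simp]
lemma actionToKernelPair_snd : actionToKernelPair q P ≫ pullback.snd q q
    = pullback.snd (P.proj ≫ q) q :=
  pullback.lift_snd _ _ _

/-- This exhibits the object of pairs (x, a) as a pullback of split epimorphisms, with canonical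
sections `actionUnit` and `actionSec`, so that the protomodular lemmas apply to it. -/
lemma isPullback_actionToKernelPair : IsPullback (pullback.fst (P.proj ≫ q) q)
    (actionToKernelPair q P) P.proj (pullback.fst q q) := by
  refine isPullback_of_existsUnique (actionToKernelPair_fst q P).symm (fun T x y e => ?_)
    fun T l l' h₁ h₂ => pullback.hom_ext h₁ ?_
  · have w : x ≫ P.proj ≫ q = (y ≫ pullback.snd q q) ≫ q := by
      rw [reassoc_of% e, pullback.condition, Category.assoc]
    refine ⟨pullback.lift x (y ≫ pullback.snd q q) w, pullback.lift_fst _ _ _, ?_⟩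
    apply pullback.hom_ext
    · rw [Category.assoc, actionToKernelPair_fst, pullback.lift_fst_assoc, e]
    · rw [Category.assoc, actionToKernelPair_snd, pullback.lift_snd]
  · rw [← actionToKernelPair_snd, reassoc_of% h₂]

lemma actionUnit_toKernelPair :
    actionUnit q P ≫ actionToKernelPair q P = P.proj ≫ (kernelPairPt q).sec := by
  apply pullback.hom_ext
  · simp only [Category.assoc, actionToKernelPair_fst, reassoc_of% @actionUnit_fst, pullback.lift_fst,
      Category.comp_id]
  · simp only [Category.assoc, actionToKernelPair_snd, actionUnit_snd, pullback.lift_snd,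
      Category.comp_id]

lemma actionSec_toKernelPair : actionSec q P ≫ actionToKernelPair q P = 𝟙 _ := by
  apply pullback.hom_ext
  · simp only [Category.assoc, actionToKernelPair_fst, reassoc_of% @actionSec_fst, P.sec_proj,
      Category.comp_id, Category.id_comp]
  · simp only [Category.assoc, actionToKernelPair_snd, actionSec_snd, Category.id_comp]

end Pullbacks

variable [StronglySemiAbelian C] {q : A ⟶ Q} {P : Pt A}

/-- Protomodularity: the pairs (x, c x) and (s a, b) together determine any map out of the object of
pairs (x, a). -/
lemma action_hom_ext {T : C} {a b : pullback (P.proj ≫ q) q ⟶ T}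
    (h₁ : actionUnit q P ≫ a = actionUnit q P ≫ b) (h₂ : actionSec q P ≫ a = actionSec q P ≫ b) :
    a = b :=
  hom_ext_of_sections (pullback.lift_fst _ _ _) (isPullback_actionToKernelPair q P)
    (actionUnit q P) (actionSec q P) (actionUnit_fst q P) (actionUnit_toKernelPair q P)
    (actionSec_toKernelPair q P) h₁ h₂

lemma isIso_of_mono_action {W : C} (m : W ⟶ pullback (P.proj ≫ q) q) [Mono m] (i : P.X ⟶ W)
    (hi : i ≫ m = actionUnit q P) (i' : pullback q q ⟶ W) (hi' : i' ≫ m = actionSec q P) :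
    IsIso m := by
  refine isIso_of_mono_of_sections (t := (kernelPairPt q).sec) (pullback.lift_fst _ _ _)
    (isPullback_actionToKernelPair q P) m i i' ?_ ?_ ?_
  · rw [reassoc_of% hi, actionUnit_fst]
  · rw [reassoc_of% hi, actionUnit_toKernelPair]
  · rw [reassoc_of% hi', actionSec_toKernelPair]

variable [HasZeroMorphisms C] {K : C} {k : K ⟶ A}

/-- A point which is trivial along `k` has, over `k`, a retraction to its kernel whose fibre is
the section. -/
lemma IsTrivialAlong.exists_retraction (hP : IsTrivialAlong k P) :
    ∃ (Y : C) (ρ : pullback P.proj k ⟶ Y), (pullbackPt k P).sec ≫ ρ = 0 ∧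
      ∀ {T : C} (x : T ⟶ pullback P.proj k), x ≫ ρ = 0 →
        x = x ≫ pullback.snd P.proj k ≫ (pullbackPt k P).sec := by
  obtain ⟨Y, ⟨e⟩⟩ := hP
  let E : pullback P.proj k ⟶ Y ⨯ K := Pt.Hom.hom e.hom
  have hE₁ : E ≫ prod.snd = pullback.snd P.proj k := Pt.hom_comp_proj e.hom
  have hE₂ : (pullbackPt k P).sec ≫ E = prod.lift 0 (𝟙 K) := Pt.sec_comp_hom e.hom
  have : IsIso E := Pt.isIso_hom e.hom
  refine ⟨Y, E ≫ prod.fst, ?_, fun {T} x hx => ?_⟩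
  · rw [reassoc_of% hE₂, prod.lift_fst]
  · rw [← cancel_mono E]
    simp only [Category.assoc, hE₂]
    apply Limits.prod.hom_ext
    · simp only [Category.assoc, hx, prod.lift_fst, comp_zero]
    · simp only [Category.assoc, hE₁, prod.lift_snd, Category.comp_id]

/-- If `P` is trivial along the kernel of `q`, the kernel pair of `q` is a normal subobject of
`actionPt q P`. -/
lemma isNormalMono_actionSecPt (w : k ≫ q = 0) (hk : IsLimit (KernelFork.ofι k w))
    (hP : IsTrivialAlong k P) : IsNormalMono (actionSecPt q P) := by
  obtain ⟨Y, ρ, hρ, hρ'⟩ := hP.exists_retraction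
  obtain ⟨B, hB⟩ := HasZeroObject.zero (C := C)
  -- Normality is tested over the zero object: there the pairs (x, a) reduce to the x with q(c x) =
  -- 0, that is to the domain of k^*P, and `actionSec` reduces to the section of k^*P.
  let g : B ⟶ A := 0
  apply (StronglySemiAbelian.normal_changeOfBase g).reflectsNormalMono
  let p : pullback (pullback.snd (P.proj ≫ q) q) g ⟶ P.X :=
    pullback.fst _ _ ≫ pullback.fst _ _
  have hp : (p ≫ P.proj) ≫ q = 0 := by
    simp only [p, Category.assoc, pullback.condition (f := P.proj ≫ q)]
    rw [pullback.condition_assoc]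
    simp [g]
  obtain ⟨κ, hκ⟩ : ∃ κ : pullback (pullback.snd (P.proj ≫ q) q) g ⟶ K, κ ≫ k = p ≫ P.proj :=
    ⟨_, (KernelFork.IsLimit.lift' hk (p ≫ P.proj) hp).2⟩
  let l : pullback (pullback.snd (P.proj ≫ q) q) g ⟶ pullback P.proj k :=
    pullback.lift p κ hκ.symm
  have hl₁ : l ≫ pullback.fst P.proj k = p := pullback.lift_fst _ _ _
  have hl₂ : l ≫ pullback.snd P.proj k = κ := pullback.lift_snd _ _ _
  have hk' : Mono k := mono_of_isLimit_fork hk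
  let Z : Pt B := ⟨Y, 0, 0, hB.eq_of_src _ _⟩
  let u : (changeOfBase g).obj (actionPt q P) ⟶ Z :=
    ⟨l ≫ ρ, hB.eq_of_tgt _ _, hB.eq_of_src _ _⟩
  refine isNormalMono_of_isPullback _ u ?_
  let m : pullback (pullback.snd q q) g ⟶ pullback (pullback.snd (P.proj ≫ q) q) g :=
    Pt.Hom.hom ((changeOfBase g).map (actionSecPt q P))
  have hm₁ : m ≫ pullback.fst _ _ = pullback.fst _ _ ≫ actionSec q P := pullback.lift_fst _ _ _
  have hm₂ : m ≫ pullback.snd _ _ = pullback.snd _ _ := pullback.lift_snd _ _ _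
  have hsec : (pullbackPt k P).sec ≫ pullback.fst P.proj k = k ≫ P.sec := pullback.lift_fst _ _ _
  change IsPullback m (pullback.snd (pullback.snd q q) g) (l ≫ ρ) (0 : B ⟶ Y)
  have hmp : m ≫ p = pullback.fst _ _ ≫ pullback.fst q q ≫ P.sec := by
    simp only [p]
    rw [reassoc_of% hm₁, actionSec_fst]
  refine isPullback_of_existsUnique ?_ (fun T x y e => ?_) fun T a b h₁ _ => ?_
  · rw [comp_zero]
    have : m ≫ l = (m ≫ κ) ≫ (pullbackPt k P).sec := by
      apply pullback.hom_ext
      · simp only [Category.assoc]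
        rw [hl₁, hsec, reassoc_of% hκ, hmp, reassoc_of% hmp, reassoc_of% P.sec_proj]
      · simp only [Category.assoc]
        rw [hl₂, (pullbackPt k P).sec_proj, Category.comp_id]
    rw [reassoc_of% this, hρ, comp_zero, comp_zero]
  · rw [comp_zero, ← Category.assoc] at e
    have hx := hρ' _ e =≫ pullback.fst P.proj k
    simp only [Category.assoc] at hx
    rw [hl₁, hsec, reassoc_of% hl₂, reassoc_of% hκ] at hx
    -- By `hx` the first coordinate equals s applied to its own projection, so the pair is the image
    -- under `actionSec` of (that projection, second coordinate).
    have e' : (x ≫ p ≫ P.proj) ≫ q = (x ≫ pullback.fst _ _ ≫ pullback.snd (P.proj ≫ q) q) ≫ q := by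
      simp only [p, Category.assoc]
      rw [pullback.condition]
    let t : T ⟶ pullback (pullback.snd q q) g := pullback.lift (pullback.lift _ _ e')
      (x ≫ pullback.snd _ _) (by
        rw [pullback.lift_snd, Category.assoc, ← pullback.condition])
    have ht : t ≫ pullback.fst _ _ = pullback.lift _ _ e' := pullback.lift_fst _ _ _
    have ht' : t ≫ pullback.snd _ _ = x ≫ pullback.snd _ _ := pullback.lift_snd _ _ _
    refine ⟨t, ?_, hB.eq_of_tgt _ _⟩
    apply pullback.hom_ext
    · rw [Category.assoc, hm₁, reassoc_of% ht]
      apply pullback.hom_ext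
      · rw [Category.assoc, actionSec_fst, pullback.lift_fst_assoc, Category.assoc]
        simp only [Category.assoc]
        exact hx.symm
      · rw [Category.assoc, actionSec_snd, pullback.lift_snd, Category.assoc]
    · rw [Category.assoc, hm₂, ht']
  · have hs : Mono (actionSec q P) :=
      ⟨fun x y e => by simpa [actionSec_toKernelPair] using e =≫ actionToKernelPair q P⟩
    refine pullback.hom_ext ?_ (hB.eq_of_tgt _ _)
    rw [← cancel_mono (actionSec q P), Category.assoc, Category.assoc, ← hm₁, reassoc_of% h₁]

end Action

variable [StronglySemiAbelian C]

/-! ### From normality to an action of the kernel pair. -/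

section Retraction

variable {A Q : C} {q : A ⟶ Q} {P : Pt A}

/-- When the kernel pair of `q` is normal in `actionPt q P`, it has a complementary retraction
onto `P`, namely the action of the kernel pair of `q` on `P`. -/
lemma exists_action_of_isNormalMono (h : IsNormalMono (actionSecPt q P)) :
    ∃ φ : pullback (P.proj ≫ q) q ⟶ P.X, actionUnit q P ≫ φ = 𝟙 _ ∧
      actionSec q P ≫ φ = pullback.snd q q ≫ P.sec := by
  obtain ⟨_, R, r₁, r₂, ⟨⟨hR⟩⟩, XX, p₁, p₂, hXX, t, ht₂, ht⟩ := h
  have ht₁ := ht.w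
  have ht' := Pt.isPullback_hom ht
  let R₁ : R.X ⟶ pullback (P.proj ≫ q) q := Pt.Hom.hom r₁
  let R₂ : R.X ⟶ pullback (P.proj ≫ q) q := Pt.Hom.hom r₂
  have hR₁₂ : R₁ ≫ pullback.snd (P.proj ≫ q) q = R₂ ≫ pullback.snd (P.proj ≫ q) q :=
    (Pt.hom_comp_proj r₁).trans (Pt.hom_comp_proj r₂).symm
  have hs₁ : R.sec ≫ R₁ = P.sec ≫ actionUnit q P :=
    (Pt.sec_comp_hom r₁).trans (sec_actionUnit q P).symm
  have hs₂ : R.sec ≫ R₂ = P.sec ≫ actionUnit q P :=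
    (Pt.sec_comp_hom r₂).trans (sec_actionUnit q P).symm
  -- The domain consists of the z related to some (x, c x), together with x; `f` forgets x. Once `f`
  -- is invertible, φ reads off x.
  let f : pullback R₂ (actionUnit q P) ⟶ pullback (P.proj ≫ q) q := pullback.fst _ _ ≫ R₁
  have hw : pullback.fst R₂ (actionUnit q P) ≫ R₂ = pullback.snd _ _ ≫ actionUnit q P :=
    pullback.condition
  -- the fibre of `f` over the zero point is trivial because the class of zero is `actionSec`
  have hf : Mono f := by
    refine mono_of_fibre_trivial f (pullback.lift R.sec P.sec hs₂) fun {T} a x e => ?_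
    have e₀ : (x ≫ pullback.fst R₂ (actionUnit q P)) ≫ R₁ = (a ≫ R.sec) ≫ R₁ := by
      simpa only [f, Category.assoc, pullback.lift_fst_assoc] using e
    have e₁ : (x ≫ pullback.fst R₂ (actionUnit q P)) ≫ Pt.Hom.hom r₁
        = (a ≫ (kernelPairPt q).sec) ≫ actionSec q P := by
      refine e₀.trans ?_
      rw [Category.assoc, Category.assoc, hs₁, sec_actionUnit, sec_actionSec]
    -- One member lies in the class given by `actionSec`, hence so does the other, which has the
    -- form (x, c x). Such a pair equals some (s a, b) only when x = s(c x).
    let τ : T ⟶ XX.X := ht'.lift _ _ e₁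
    have hτ : τ ≫ Pt.Hom.hom t = x ≫ pullback.fst R₂ (actionUnit q P) := ht'.lift_fst _ _ _
    have ht₂' : Pt.Hom.hom t ≫ R₂ = Pt.Hom.hom p₂ ≫ actionSec q P := congrArg Pt.Hom.hom ht₂
    have e₂ : (x ≫ pullback.snd R₂ (actionUnit q P)) ≫ actionUnit q P
        = τ ≫ Pt.Hom.hom p₂ ≫ actionSec q P := by
      rw [← ht₂', reassoc_of% hτ, hw, Category.assoc]
    have e₃ : x ≫ pullback.snd R₂ (actionUnit q P) ≫ P.proj = a := by
      have := e₀ =≫ pullback.snd (P.proj ≫ q) q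
      simp only [Category.assoc] at this
      rw [hR₁₂, reassoc_of% hw, actionUnit_snd, reassoc_of% hs₂, actionUnit_snd, P.sec_proj,
        Category.comp_id] at this
      exact this
    have e₄ : x ≫ pullback.snd R₂ (actionUnit q P) = a ≫ P.sec := by
      have h₁ := e₂ =≫ pullback.fst (P.proj ≫ q) q
      simp only [Category.assoc, actionUnit_fst, actionSec_fst, Category.comp_id] at h₁
      have h₂ := h₁ =≫ P.proj
      simp only [Category.assoc, P.sec_proj, Category.comp_id] at h₂
      rw [e₃] at h₂
      rw [h₁, h₂]
      simp only [Category.assoc]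
    apply pullback.hom_ext
    · rw [Category.assoc, pullback.lift_fst]
      refine Pt.hom_eq_of_jointlyMono hR.toJointlyMono₂ e₀ ?_
      change (x ≫ pullback.fst R₂ (actionUnit q P)) ≫ R₂ = (a ≫ R.sec) ≫ R₂
      rw [Category.assoc, hw, reassoc_of% e₄, Category.assoc, hs₂]
    · rw [Category.assoc, pullback.lift_snd, e₄]
  let ρ : pullback (P.proj ≫ q) q ⟶ R.X := Pt.Hom.hom hR.r
  have hρ₁ : ρ ≫ R₁ = 𝟙 _ := congrArg Pt.Hom.hom hR.reflexivity₁
  have hρ₂ : ρ ≫ R₂ = 𝟙 _ := congrArg Pt.Hom.hom hR.reflexivity₂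
  let i : P.X ⟶ pullback R₂ (actionUnit q P) := pullback.lift (actionUnit q P ≫ ρ) (𝟙 _)
    (by rw [Category.assoc, hρ₂, Category.comp_id, Category.id_comp])
  have hi : i ≫ f = actionUnit q P := by
    rw [pullback.lift_fst_assoc, Category.assoc, hρ₁, Category.comp_id]
  -- The zero endomorphism (a, b) ↦ (b, b). Pairing it with the identity inside the class shows that
  -- (s a, b) is related to (s b, b), the unit of s b; this forces φ(s a, b) = s b.
  let z : kernelPairPt q ⟶ kernelPairPt q :=
    { hom := pullback.snd q q ≫ (kernelPairPt q).sec
      hom_proj := by rw [Category.assoc, (kernelPairPt q).sec_proj, Category.comp_id]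
      sec_hom := by rw [← Category.assoc, (kernelPairPt q).sec_proj, Category.id_comp] }
  obtain ⟨l, hl₁, hl₂⟩ := BinaryFan.IsLimit.lift' hXX (𝟙 (kernelPairPt q)) z
  replace hl₁ : l ≫ p₁ = 𝟙 _ := hl₁
  replace hl₂ : l ≫ p₂ = z := hl₂
  let n : pullback q q ⟶ R.X := Pt.Hom.hom (l ≫ t)
  have hn₁ : n ≫ R₁ = actionSec q P :=
    congrArg Pt.Hom.hom (show (l ≫ t) ≫ r₁ = actionSecPt q P by
      rw [Category.assoc, ht₁, reassoc_of% hl₁])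
  have hn₂ : n ≫ R₂ = pullback.snd q q ≫ P.sec ≫ actionUnit q P := by
    rw [sec_actionUnit, ← sec_actionSec]
    exact (congrArg Pt.Hom.hom (show (l ≫ t) ≫ r₂ = z ≫ actionSecPt q P by
      rw [Category.assoc, ht₂, reassoc_of% hl₂])).trans (Category.assoc _ _ _)
  let i' : pullback q q ⟶ pullback R₂ (actionUnit q P) :=
    pullback.lift n (pullback.snd q q ≫ P.sec) (by rw [hn₂, Category.assoc])
  have hi' : i' ≫ f = actionSec q P := by
    rw [pullback.lift_fst_assoc, hn₁]
  have := isIso_of_mono_action f i hi i' hi'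
  refine ⟨inv f ≫ pullback.snd _ _, ?_, ?_⟩
  · have : i = actionUnit q P ≫ inv f := (IsIso.eq_comp_inv f).2 hi
    rw [← reassoc_of% this, pullback.lift_snd]
  · have : i' = actionSec q P ≫ inv f := (IsIso.eq_comp_inv f).2 hi'
    rw [← reassoc_of% this, pullback.lift_snd]

end Retraction

/-! ### Descent of a point along its action. -/

section Descent

variable {A Q : C} {q : A ⟶ Q} {P : Pt A} {φ : pullback (P.proj ≫ q) q ⟶ P.X}

/-- Compatibility of φ with the projections is no extra axiom: it holds on the pairs (x, c x) and (s
a, b), hence everywhere. -/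
lemma action_comp_proj (h₁ : actionUnit q P ≫ φ = 𝟙 _)
    (h₂ : actionSec q P ≫ φ = pullback.snd q q ≫ P.sec) :
    φ ≫ P.proj = pullback.snd (P.proj ≫ q) q := by
  apply action_hom_ext
  · rw [reassoc_of% h₁, actionUnit_snd]
  · rw [reassoc_of% h₂, P.sec_proj, actionSec_snd, Category.comp_id]

/-- The action of a kernel pair is associative. -/
lemma action_assoc (h₁ : actionUnit q P ≫ φ = 𝟙 _)
    (h₂ : actionSec q P ≫ φ = pullback.snd q q ≫ P.sec) {T : C}
    (x y z : T ⟶ pullback (P.proj ≫ q) q)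
    (hy : y ≫ pullback.fst _ _ = x ≫ φ) (hz : z ≫ pullback.fst _ _ = x ≫ pullback.fst _ _)
    (hyz : y ≫ pullback.snd _ _ = z ≫ pullback.snd _ _) : y ≫ φ = z ≫ φ := by
  have hφ := action_comp_proj h₁ h₂
  -- Generic case: `U` is the object of triples (x, a, b), with `τ` = (φ(x, a), b) and `σ` = (x, b).
  -- It is again a pullback of split epimorphisms, so φτ = φσ is checked on the triples (x, a, a)
  -- and (s a, a, b).
  let U := pullback (pullback.snd (P.proj ≫ q) q) (pullback.fst q q)
  let p : U ⟶ pullback (P.proj ≫ q) q := pullback.fst _ _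
  let p' : U ⟶ pullback q q := pullback.snd _ _
  have hp : p ≫ pullback.snd _ _ = p' ≫ pullback.fst q q := pullback.condition
  have hp' : p ≫ pullback.snd _ _ ≫ q = p' ≫ pullback.snd q q ≫ q := by
    rw [reassoc_of% hp, pullback.condition]
  let σ : U ⟶ pullback (P.proj ≫ q) q := pullback.lift (p ≫ pullback.fst _ _)
    (p' ≫ pullback.snd _ _) (by
      rw [Category.assoc, pullback.condition, hp', Category.assoc])
  have hσ₁ : σ ≫ pullback.fst _ _ = p ≫ pullback.fst _ _ := pullback.lift_fst _ _ _
  have hσ₂ : σ ≫ pullback.snd _ _ = p' ≫ pullback.snd _ _ := pullback.lift_snd _ _ _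
  let τ : U ⟶ pullback (P.proj ≫ q) q := pullback.lift (p ≫ φ)
    (p' ≫ pullback.snd _ _) (by
      rw [Category.assoc, reassoc_of% hφ, hp', Category.assoc])
  have hτ₁ : τ ≫ pullback.fst _ _ = p ≫ φ := pullback.lift_fst _ _ _
  have hτ₂ : τ ≫ pullback.snd _ _ = p' ≫ pullback.snd _ _ := pullback.lift_snd _ _ _
  let i : pullback (P.proj ≫ q) q ⟶ U := pullback.lift (𝟙 _)
    (pullback.snd _ _ ≫ (kernelPairPt q).sec)
    (by rw [Category.assoc, pullback.lift_fst, Category.comp_id, Category.id_comp])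
  have hi : i ≫ p = 𝟙 _ := pullback.lift_fst _ _ _
  have hi' : i ≫ p' = pullback.snd _ _ ≫ (kernelPairPt q).sec := pullback.lift_snd _ _ _
  let i' : pullback q q ⟶ U := pullback.lift (pullback.fst q q ≫ P.sec ≫ actionUnit q P) (𝟙 _)
    (by simp)
  have hj : i' ≫ p = pullback.fst q q ≫ P.sec ≫ actionUnit q P := pullback.lift_fst _ _ _
  have hj' : i' ≫ p' = 𝟙 _ := pullback.lift_snd _ _ _
  have key : τ ≫ φ = σ ≫ φ := by
    refine hom_ext_of_sections (pullback.lift_fst _ _ _) (IsPullback.of_hasPullback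
      (pullback.snd (P.proj ≫ q) q) (pullback.fst q q)) i i' hi hi' hj' ?_ ?_
    · have e₁ : i ≫ τ = φ ≫ actionUnit q P := by
        apply pullback.hom_ext
        · rw [Category.assoc, hτ₁, reassoc_of% hi, Category.assoc, actionUnit_fst,
            Category.comp_id]
        · rw [Category.assoc, hτ₂, reassoc_of% hi', pullback.lift_snd, Category.assoc,
            actionUnit_snd, hφ, Category.comp_id]
      have e₂ : i ≫ σ = 𝟙 _ := by
        apply pullback.hom_ext
        · rw [Category.assoc, hσ₁, reassoc_of% hi, Category.id_comp]
        · rw [Category.assoc, hσ₂, reassoc_of% hi', pullback.lift_snd, Category.comp_id,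
            Category.id_comp]
      rw [reassoc_of% e₁, reassoc_of% e₂, h₁, Category.comp_id]
    · have e₁ : i' ≫ τ = actionSec q P := by
        apply pullback.hom_ext
        · rw [Category.assoc, hτ₁, reassoc_of% hj, h₁, Category.comp_id, actionSec_fst]
        · rw [Category.assoc, hτ₂, reassoc_of% hj', actionSec_snd]
      have e₂ : i' ≫ σ = actionSec q P := by
        apply pullback.hom_ext
        · rw [Category.assoc, hσ₁, reassoc_of% hj, actionUnit_fst, Category.comp_id, actionSec_fst]
        · rw [Category.assoc, hσ₂, reassoc_of% hj', actionSec_snd]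
      rw [reassoc_of% e₁, reassoc_of% e₂]
  have hxy : x ≫ pullback.snd _ _ = y ≫ pullback.fst _ _ ≫ P.proj := by
    rw [reassoc_of% hy, hφ]
  let l : T ⟶ U := pullback.lift x (pullback.lift (x ≫ pullback.snd _ _) (y ≫ pullback.snd _ _)
    (by rw [hxy, Category.assoc, Category.assoc, Category.assoc, pullback.condition]))
    (by rw [pullback.lift_fst])
  have hl : l ≫ p = x := pullback.lift_fst _ _ _
  have hl' : l ≫ p' = pullback.lift _ _ _ := pullback.lift_snd _ _ _
  have e₁ : l ≫ τ = y := by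
    apply pullback.hom_ext
    · rw [Category.assoc, hτ₁, reassoc_of% hl, hy]
    · rw [Category.assoc, hτ₂, reassoc_of% hl', pullback.lift_snd]
  have e₂ : l ≫ σ = z := by
    apply pullback.hom_ext
    · rw [Category.assoc, hσ₁, reassoc_of% hl, hz]
    · rw [Category.assoc, hσ₂, reassoc_of% hl', pullback.lift_snd, hyz]
  rw [← e₁, ← e₂, Category.assoc, Category.assoc, key]

/-- The unit law gives reflexivity and associativity gives transitivity. Symmetry is φ(φ(x, a), c x)
= φ(x, c x) = x. The pair is jointly monic because a is the projection of φ(x, a). -/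
lemma isEquivalenceRelation_action (h₁ : actionUnit q P ≫ φ = 𝟙 _)
    (h₂ : actionSec q P ≫ φ = pullback.snd q q ≫ P.sec) :
    IsEquivalenceRelation (pullback.fst (P.proj ≫ q) q) φ := by
  have hφ := action_comp_proj h₁ h₂
  let s : pullback (P.proj ≫ q) q ⟶ pullback (P.proj ≫ q) q :=
    pullback.lift φ (pullback.fst _ _ ≫ P.proj)
      (by rw [reassoc_of% hφ, ← pullback.condition, Category.assoc])
  have hs : s ≫ pullback.fst _ _ = φ := pullback.lift_fst _ _ _
  have hs' : s ≫ pullback.snd _ _ = pullback.fst _ _ ≫ P.proj := pullback.lift_snd _ _ _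
  have hsφ : s ≫ φ = pullback.fst _ _ := by
    rw [action_assoc h₁ h₂ (𝟙 _) s (pullback.fst _ _ ≫ actionUnit q P)
      (by rw [hs, Category.id_comp])
      (by rw [Category.assoc, actionUnit_fst, Category.comp_id, Category.id_comp])
      (by rw [hs', Category.assoc, actionUnit_snd]), Category.assoc, h₁, Category.comp_id]
  let t : pullback φ (pullback.fst (P.proj ≫ q) q) ⟶ pullback (P.proj ≫ q) q :=
    pullback.lift (pullback.fst _ _ ≫ pullback.fst _ _) (pullback.snd _ _ ≫ pullback.snd _ _) (by
      simp only [Category.assoc]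
      rw [← pullback.condition (f := P.proj ≫ q) (g := q), ← pullback.condition_assoc,
        pullback.condition (f := P.proj ≫ q) (g := q), reassoc_of% hφ])
  have ht : t ≫ pullback.fst _ _ = pullback.fst _ _ ≫ pullback.fst _ _ := pullback.lift_fst _ _ _
  have ht' : t ≫ pullback.snd _ _ = pullback.snd _ _ ≫ pullback.snd _ _ := pullback.lift_snd _ _ _
  have htφ : t ≫ φ = pullback.snd φ (pullback.fst (P.proj ≫ q) q) ≫ φ :=
    (action_assoc h₁ h₂ (pullback.fst _ _) _ t pullback.condition.symm ht ht'.symm).symm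
  exact ⟨⟨{
    right_cancellation := fun T x y e e' => pullback.hom_ext e (by
      rw [← hφ, reassoc_of% e'])
    r := actionUnit q P
    reflexivity₁ := actionUnit_fst q P
    reflexivity₂ := h₁
    s := s
    symmetry₁ := hs
    symmetry₂ := hsφ
    c := _
    isLimit := (IsPullback.of_hasPullback φ (pullback.fst (P.proj ≫ q) q)).isLimit
    t := t
    transitivity₁ := ht
    transitivity₂ := htφ }⟩⟩

/-- An action of the kernel pair of a regular epimorphism on a point descends this point. -/
lemma exists_isCartesian_of_action [IsRegularEpi q] (h₁ : actionUnit q P ≫ φ = 𝟙 _)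
    (h₂ : actionSec q P ≫ φ = pullback.snd q q ≫ P.sec) :
    ∃ (D : Pt Q) (γ : HomOver q P D), γ.IsCartesian := by
  have hφ := action_comp_proj h₁ h₂
  obtain ⟨Y, f, hf⟩ := BarrExact.effective _ _ (isEquivalenceRelation_action h₁ h₂)
  have := Regular.hasCoequalizer_of_isKernelPair hf
  -- The map given by effectiveness need not be a regular epimorphism; the coequalizer is one, and
  -- has the same kernel pair.
  let D := coequalizer (pullback.fst (P.proj ≫ q) q) φ
  obtain ⟨γ, hγ, hreg, hker⟩ : ∃ γ : P.X ⟶ D, γ = coequalizer.π _ _ ∧ IsRegularEpi γ ∧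
      IsKernelPair γ (pullback.fst (P.proj ≫ q) q) φ := by
    refine ⟨_, rfl, inferInstance, ?_⟩
    refine IsKernelPair.cancel_right (f₂ := coequalizer.desc f hf.w) (coequalizer.condition _ _) ?_
    rwa [coequalizer.π_desc]
  have hγe : Epi γ := by rw [hγ]; infer_instance
  have hqe : Epi q := inferInstance
  obtain ⟨d, hd⟩ : ∃ d : D ⟶ Q, γ ≫ d = P.proj ≫ q :=
    IsRegularEpi.exists_of_isKernelPair γ hker _ (by
      rw [pullback.condition, reassoc_of% hφ])
  obtain ⟨s, hs⟩ : ∃ s : Q ⟶ D, q ≫ s = P.sec ≫ γ :=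
    IsRegularEpi.exists_of_isKernelPair q (IsKernelPair.of_hasPullback q) _ (by
      rw [← reassoc_of% h₂, ← hker.w, reassoc_of% @actionSec_fst])
  have hsd : s ≫ d = 𝟙 Q := by
    rw [← cancel_epi q, reassoc_of% hs, hd, ← Category.assoc, P.sec_proj, Category.id_comp,
      Category.comp_id]
  refine ⟨⟨D, d, s, hsd⟩, ⟨γ, hd, hs.symm⟩, ?_⟩
  change IsPullback γ P.proj d q
  let ι : P.X ⟶ pullback d q := pullback.lift γ P.proj hd
  have hι₁ : ι ≫ pullback.fst d q = γ := pullback.lift_fst _ _ _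
  have hι₂ : ι ≫ pullback.snd d q = P.proj := pullback.lift_snd _ _ _
  -- If x and y agree under `γ` and over `A`, then y = φ(x, c y) = φ(x, c x) = x.
  have hmono : Mono ι := by
    refine ⟨fun {T} x y e => ?_⟩
    have e₁ : x ≫ γ = y ≫ γ := by rw [← hι₁, reassoc_of% e]
    have e₂ : x ≫ P.proj = y ≫ P.proj := by rw [← hι₂, reassoc_of% e]
    have e₃ : hker.lift x y e₁ = x ≫ actionUnit q P := by
      apply pullback.hom_ext
      · rw [hker.lift_fst, Category.assoc, actionUnit_fst, Category.comp_id]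
      · rw [← hφ, hker.lift_snd_assoc, Category.assoc, hφ, actionUnit_snd, e₂]
    rw [← hker.lift_snd x y e₁, e₃, Category.assoc, h₁, Category.comp_id]
  -- Pulling D ×_Q A back along `γ` gives the pairs (x, a). So `φ ≫ ι` is a base change of `γ`, a
  -- regular epimorphism, and `ι` is a strong epimorphism.
  have hpb : IsPullback (φ ≫ ι) (pullback.fst (P.proj ≫ q) q) (pullback.fst d q) γ := by
    refine IsPullback.of_right (h₁₂ := pullback.snd d q) (h₂₂ := d) (v₁₃ := q) ?_ ?_
      (IsPullback.of_hasPullback d q).flip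
    · rw [Category.assoc, hι₂, hφ, hd]
      exact (IsPullback.of_hasPullback (P.proj ≫ q) q).flip
    · rw [Category.assoc, hι₁, hker.w]
  have hreg' : IsRegularEpi (φ ≫ ι) :=
    Regular.regularEpiIsStableUnderBaseChange.of_isPullback hpb.flip hreg
  have : StrongEpi ι := strongEpi_of_strongEpi φ ι
  have : IsIso ι := isIso_of_mono_of_strongEpi ι
  exact IsPullback.of_iso_pullback ⟨hd⟩ (asIso ι) hι₁ hι₂

end Descent

/-! ### Opcartesianness over a regular epimorphism. -/

section Extension

variable {A Q : C} {q : A ⟶ Q} [IsRegularEpi q]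

lemma HomOver.IsCartesian.isRegularEpi {P : Pt A} {D : Pt Q} {γ : HomOver q P D}
    (hγ : γ.IsCartesian) : IsRegularEpi γ.hom :=
  Regular.regularEpiIsStableUnderBaseChange.of_isPullback (IsPullback.flip hγ) ‹_›

lemma HomOver.IsCartesian.pt_hom_ext {P : Pt A} {D D' : Pt Q} {γ : HomOver q P D}
    (hγ : γ.IsCartesian) {f g : D ⟶ D'} (h : γ.hom ≫ Pt.Hom.hom f = γ.hom ≫ Pt.Hom.hom g) :
    f = g := by
  have := hγ.isRegularEpi
  exact Pt.hom_ext ((cancel_epi γ.hom).1 h)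

/-- A cartesian morphism over a regular epimorphism is also opcartesian. -/
lemma HomOver.IsCartesian.exists_extension {P P' : Pt A} {D D' : Pt Q} {γ : HomOver q P D}
    (hγ : γ.IsCartesian) (γ' : HomOver q P' D') (f : P ⟶ P') :
    ∃ h : D ⟶ D', Pt.Hom.hom f ≫ γ'.hom = γ.hom ≫ Pt.Hom.hom h := by
  have hreg := hγ.isRegularEpi
  have hepi : Epi γ.hom := inferInstance
  have hq : Epi q := inferInstance
  have hpb : IsPullback γ.hom P.proj D.proj q := hγ
  -- The pullback square defines φ(x, a) as the element over a with the same image as x under `γ`.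
  -- The kernel pair of `γ` therefore consists of pairs (x, φ(x, a)), and `key` lets the map
  -- descend.
  let φ : pullback (P.proj ≫ q) q ⟶ P.X := hpb.lift (pullback.fst _ _ ≫ γ.hom) (pullback.snd _ _)
    (by rw [Category.assoc, γ.hom_proj, pullback.condition])
  have hφ₁ : φ ≫ γ.hom = pullback.fst _ _ ≫ γ.hom := hpb.lift_fst _ _ _
  have hφ₂ : φ ≫ P.proj = pullback.snd _ _ := hpb.lift_snd _ _ _
  have h₁ : actionUnit q P ≫ φ = 𝟙 _ := by
    apply hpb.hom_ext
    · rw [Category.assoc, hφ₁, reassoc_of% @actionUnit_fst, Category.id_comp]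
    · rw [Category.assoc, hφ₂, actionUnit_snd, Category.id_comp]
  have h₂ : actionSec q P ≫ φ = pullback.snd q q ≫ P.sec := by
    apply hpb.hom_ext
    · rw [Category.assoc, hφ₁, reassoc_of% @actionSec_fst, Category.assoc, γ.sec_hom,
        pullback.condition_assoc]
    · rw [Category.assoc, hφ₂, actionSec_snd, Category.assoc, P.sec_proj, Category.comp_id]
  have key : pullback.fst (P.proj ≫ q) q ≫ Pt.Hom.hom f ≫ γ'.hom
      = φ ≫ Pt.Hom.hom f ≫ γ'.hom := by
    apply action_hom_ext
    · rw [reassoc_of% @actionUnit_fst, reassoc_of% h₁]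
    · rw [reassoc_of% @actionSec_fst, reassoc_of% h₂, reassoc_of% @Pt.sec_comp_hom, γ'.sec_hom,
        pullback.condition_assoc]
  obtain ⟨h, hh⟩ := IsRegularEpi.exists_of_isKernelPair γ.hom
    (IsKernelPair.of_hasPullback γ.hom) (Pt.Hom.hom f ≫ γ'.hom) (by
      have e : pullback.fst γ.hom γ.hom ≫ P.proj ≫ q = (pullback.snd γ.hom γ.hom ≫ P.proj) ≫ q := by
        rw [← γ.hom_proj, pullback.condition_assoc, γ.hom_proj, Category.assoc]
      have e' : pullback.lift _ _ e ≫ φ = pullback.snd γ.hom γ.hom := by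
        apply hpb.hom_ext
        · rw [Category.assoc, hφ₁, pullback.lift_fst_assoc, pullback.condition]
        · rw [Category.assoc, hφ₂, pullback.lift_snd]
      rw [← e', Category.assoc, ← key, pullback.lift_fst_assoc])
  refine ⟨⟨h, ?_, ?_⟩, hh.symm⟩
  · rw [← cancel_epi γ.hom, reassoc_of% hh, γ'.hom_proj, reassoc_of% @Pt.hom_comp_proj, γ.hom_proj]
  · rw [← cancel_epi q, ← Category.assoc, ← γ.sec_hom, Category.assoc, hh,
      reassoc_of% @Pt.sec_comp_hom, γ'.sec_hom]

end Extension

/-! ### The functor and its uniqueness. -/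

section PushForward

variable [HasZeroMorphisms C] {K A Q : C} {k : K ⟶ A} {q : A ⟶ Q} [IsRegularEpi q]

/-- The push-forward determined by a choice of cartesian morphisms over `q`. -/
noncomputable def pushForwardOf (D : (IsTrivialAlong k).FullSubcategory → Pt Q)
    (γ : ∀ P, HomOver q P.obj (D P)) (hγ : ∀ P, (γ P).IsCartesian) : PushForward k q where
  functor :=
    { obj := D
      -- The chosen extension is the only one, as `γ` is epic; hence the functor laws can be checked
      -- after composing with `γ`.
      map {P P'} f := ((hγ P).exists_extension (γ P') f.hom).choose
      map_id P := (hγ P).pt_hom_ext (((hγ P).exists_extension (γ P) _).choose_spec.symm.trans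
        ((Category.id_comp _).trans (Category.comp_id _).symm))
      map_comp {P P' P''} f g := (hγ P).pt_hom_ext (by
        rw [← ((hγ P).exists_extension (γ P'') (f ≫ g).hom).choose_spec, Pt.hom_comp,
          ← Category.assoc, ← ((hγ P).exists_extension (γ P') f.hom).choose_spec,
          Category.assoc, ← ((hγ P').exists_extension (γ P'') g.hom).choose_spec,
          ← Category.assoc]
        rfl) }
  unit := γ
  cartesian := hγ
  naturality {P P'} f := ((hγ P).exists_extension (γ P') f.hom).choose_spec

/-- The comparison morphism between two push-forwards. -/
lemma PushForward.exists_natTrans (F F' : PushForward k q) :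
    ∃ α : F.functor ⟶ F'.functor,
      ∀ P, (F.unit P).hom ≫ Pt.Hom.hom (α.app P) = (F'.unit P).hom := by
  choose a ha using fun P => (F.cartesian P).exists_extension (F'.unit P) (𝟙 P.obj)
  have ha' (P) : (F.unit P).hom ≫ Pt.Hom.hom (a P) = (F'.unit P).hom :=
    (ha P).symm.trans (Category.id_comp _)
  refine ⟨⟨a, fun {P P'} f => (F.cartesian P).pt_hom_ext ?_⟩, ha'⟩
  rw [Pt.hom_comp, Pt.hom_comp, ← Category.assoc, ← F.naturality, Category.assoc, ha',
    ← Category.assoc, ha', F'.naturality]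

lemma PushForward.natTrans_ext {F : PushForward k q}
    {G : (IsTrivialAlong k).FullSubcategory ⥤ Pt Q} {α β : F.functor ⟶ G}
    (h : ∀ P, (F.unit P).hom ≫ Pt.Hom.hom (α.app P) = (F.unit P).hom ≫ Pt.Hom.hom (β.app P)) :
    α = β :=
  NatTrans.ext (funext fun P => (F.cartesian P).pt_hom_ext (h P))

lemma PushForward.existsUnique_iso (F F' : PushForward k q) :
    ∃! α : F.functor ≅ F'.functor,
      ∀ P, (F.unit P).hom ≫ Pt.Hom.hom (α.hom.app P) = (F'.unit P).hom := by
  obtain ⟨α, hα⟩ := F.exists_natTrans F'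
  obtain ⟨β, hβ⟩ := F'.exists_natTrans F
  refine ⟨⟨α, β, natTrans_ext fun P => ?_, natTrans_ext fun P => ?_⟩, hα, fun α' hα' =>
    Iso.ext (natTrans_ext fun P => (hα' P).trans (hα P).symm)⟩
  · rw [NatTrans.comp_app, Pt.hom_comp, ← Category.assoc, hα, hβ]
    exact (Category.comp_id _).symm
  · rw [NatTrans.comp_app, Pt.hom_comp, ← Category.assoc, hβ, hα]
    exact (Category.comp_id _).symm

end PushForward

end SplitEpis

theorem corollary4p2 {C : Type u} [Category.{v} C] [HasZeroMorphisms C]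
    [SplitEpis.StronglySemiAbelian C] {K A Q : C} (q : A ⟶ Q) (hq : IsRegularEpi q)
    (k : K ⟶ A) (w : k ≫ q = 0) (hk : IsLimit (KernelFork.ofι k w)) :
    ∃ F : SplitEpis.PushForward k q,
      ∀ F' : SplitEpis.PushForward k q,
        ∃! α : F.functor ≅ F'.functor,
          ∀ P, (F.unit P).hom ≫ SplitEpis.Pt.Hom.hom (α.hom.app P) = (F'.unit P).hom := by
  have key (P : (SplitEpis.IsTrivialAlong k).FullSubcategory) :
      ∃ (D : SplitEpis.Pt Q) (γ : SplitEpis.HomOver q P.obj D), γ.IsCartesian := by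
    obtain ⟨φ, h₁, h₂⟩ := SplitEpis.exists_action_of_isNormalMono
      (SplitEpis.isNormalMono_actionSecPt w hk P.property)
    exact SplitEpis.exists_isCartesian_of_action h₁ h₂
  choose D γ hγ using key
  exact ⟨SplitEpis.pushForwardOf D γ hγ, fun F' => SplitEpis.PushForward.existsUnique_iso _ F'⟩
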